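/- Let $M$ be a strongly causal spacetime: a connected, Hausdorff, second countable smooth manifold with a smooth Lorentzian metric and a time orientation, such that every neighbourhood $U$ of a point $p$ contains a neighbourhood $V$ of $p$ with the property that every future-directed causal curve with end points in $V$ stays in $U$. For $x,y\in M$ write $x\ll y$ if there is a future-directed (piecewise smooth) timelike curve from $x$ to $y$, and for $S\subset M$ put $I^-[S]=\{x: x\ll s \text{ for some } s\in S\}$, $I^+[S]=\{x: s\ll x\text{ for some } s\in S\}$. A past set is a set $P\subset M$ with $I^-[P]=P$; an IP is a nonempty past set that is not the union of two proper subsets which are past sets. Future sets and IFs are defined dually. An IP $P$ and an IF $F$ are called paired if $F$ is maximal among the IFs contained in $I^+[\{x: p\ll x\ \forall p\in P\}]$ and $P$ is maximal among the IPs contained in $I^-[\{x: x\ll f\ \forall f\in F\}]$. The causal completion $\bar M$ is the set of all pairs $\bar P=(P,P^*)$ such that $P$ is an IP and $P^*$ an IF paired with it, or $P$ is an IP paired with no IF and $P^*=\emptyset$, or $P^*$ is an IF paired with no IP and $P=\emptyset$. Write $I^-(\bar P)=P$ and $I^+(\bar P)=P^*$. The chronological past of $\bar P$ in $\bar M$ is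 $$I^-_C(\bar P)=\{\bar Q\in\bar M : I^+(\bar Q)\cap I^-(\bar P)\neq\emptyset\}.$$ A sequence of sets $A_n\subset M$ is said to converge to $A\subset M$ if each $x\in A$ lies in $A_n$ for all large $n$, and each $x\notin \mathrm{Cl}(A)$ lies outside $\mathrm{Cl}(A_n)$ for all large $n$. For $\bar S\subset\bar M$ let $$L^+_{IF}(\bar S)=\Big\{\bar P: \emptyset\ne I^+(\bar P)\subset\bigcup_{\bar Q\in\bar S}I^+(\bar Q)\Big\},$$ let $\mathrm{Cl}_{FB}(\bar S)$ be the union of $\bar S$ and the set of all $\bar P$ with $I^+(\bar P)=\emptyset$ such that $I^-(\bar P_n)$ converges to $I^-(\bar P)$ for some sequence $(\bar P_n)$ in $\bar S$, and let $L^+(\bar S)=\mathrm{Cl}_{FB}(\bar S\cup L^+_{IF}(\bar S))$; define $L^-(\bar S)$ dually, exchanging pasts and futures. Let $\bar{\mathcal T}$ be the coarsest topology on $\bar M$ in which all the sets $L^+(\bar S)$ and $L^-(\bar S)$, $\bar S\subset\bar M$, are closed. Then $I^-_C$ is inner continuous with respect to $\bar{\mathcal T}$: for every $\bar P\in\bar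 M$ and every compact set $C\subset I^-_C(\bar P)$ there is an open neighbourhood $U$ of $\bar P$ such that $C\subset I^-_C(u)$ for all $u\in U$. -/

import Mathlib

open Set Filter
open scoped Manifold ContDiff Topology

/-- Model space of a spacetime of dimension `n + 1`. -/
abbrev SpacetimeModel (n : ℕ) : Type := EuclideanSpace ℝ (Fin (n + 1))

/-- A smooth Lorentzian metric of signature `(-,+,…,+)` on an `(n+1)`-dimensional smooth manifold,
together with a time orientation, given by a continuous timelike vector field. -/
structure LorentzianStructure (n : ℕ) (M : Type*) [TopologicalSpace M]
    [ChartedSpace (SpacetimeModel n) M] [IsManifold 𝓘(ℝ, SpacetimeModel n) ∞ M] where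
  /-- the metric tensor -/
  metric : ∀ x : M, TangentSpace 𝓘(ℝ, SpacetimeModel n) x →L[ℝ]
    TangentSpace 𝓘(ℝ, SpacetimeModel n) x →L[ℝ] ℝ
  symm : ∀ (x : M) (v w : TangentSpace 𝓘(ℝ, SpacetimeModel n) x), metric x v w = metric x w v
  /-- Lorentzian signature: some vector is timelike, with positive definite orthogonal complement -/
  lorentzian : ∀ x : M, ∃ v : TangentSpace 𝓘(ℝ, SpacetimeModel n) x, metric x v v < 0 ∧
    ∀ w : TangentSpace 𝓘(ℝ, SpacetimeModel n) x, metric x v w = 0 → w ≠ 0 → 0 < metric x w w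
  smooth : ContMDiff 𝓘(ℝ, SpacetimeModel n)
    (𝓘(ℝ, SpacetimeModel n).prod
      𝓘(ℝ, SpacetimeModel n →L[ℝ] SpacetimeModel n →L[ℝ] ℝ)) ∞
    (fun x ↦ Bundle.TotalSpace.mk' (SpacetimeModel n →L[ℝ] SpacetimeModel n →L[ℝ] ℝ)
      (E := fun x : M ↦ TangentSpace 𝓘(ℝ, SpacetimeModel n) x →L[ℝ]
        TangentSpace 𝓘(ℝ, SpacetimeModel n) x →L[ℝ] ℝ) x (metric x))
  /-- the time-orienting vector field -/
  timeField : ∀ x : M, TangentSpace 𝓘(ℝ, SpacetimeModel n) x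
  timeField_timelike : ∀ x : M, metric x (timeField x) (timeField x) < 0
  timeField_continuous :
    Continuous (fun x ↦ (⟨x, timeField x⟩ : TangentBundle 𝓘(ℝ, SpacetimeModel n) M))

namespace LorentzianStructure

variable {n : ℕ} {M : Type*} [TopologicalSpace M] [ChartedSpace (SpacetimeModel n) M]
  [IsManifold 𝓘(ℝ, SpacetimeModel n) ∞ M]

/-- Future-directed timelike vectors at `x`. -/
def futureTimelike (g : LorentzianStructure n M) (x : M) :
    Set (TangentSpace 𝓘(ℝ, SpacetimeModel n) x) :=
  {v | g.metric x v v < 0 ∧ g.metric x v (g.timeField x) < 0}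

/-- Future-directed causal (timelike or null, nonzero) vectors at `x`. -/
def futureCausal (g : LorentzianStructure n M) (x : M) :
    Set (TangentSpace 𝓘(ℝ, SpacetimeModel n) x) :=
  {v | v ≠ 0 ∧ g.metric x v v ≤ 0 ∧ g.metric x v (g.timeField x) < 0}

end LorentzianStructure

/-- `PiecewiseCurve K γ a b`: on `[a, b]` (with `a < b`) the curve `γ` is piecewise smooth, and all
its velocities, including the one-sided ones at end points and break points, lie in the field of
cones `K`. -/
inductive PiecewiseCurve {n : ℕ} {M : Type*} [TopologicalSpace M]
    [ChartedSpace (SpacetimeModel n) M]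
    (K : ∀ x : M, Set (TangentSpace 𝓘(ℝ, SpacetimeModel n) x)) (γ : ℝ → M) : ℝ → ℝ → Prop
  | smooth {a b : ℝ} (hab : a < b)
      (hγ : ContMDiffOn 𝓘(ℝ, ℝ) 𝓘(ℝ, SpacetimeModel n) ∞ γ (Icc a b))
      (hK : ∀ t ∈ Icc a b,
        mfderivWithin 𝓘(ℝ, ℝ) 𝓘(ℝ, SpacetimeModel n) γ (Icc a b) t (1 : ℝ) ∈ K (γ t)) :
      PiecewiseCurve K γ a b
  | concat {a b c : ℝ} (hab : PiecewiseCurve K γ a b) (hbc : PiecewiseCurve K γ b c) :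
      PiecewiseCurve K γ a c

namespace LorentzianStructure

variable {n : ℕ} {M : Type*} [TopologicalSpace M] [ChartedSpace (SpacetimeModel n) M]
  [IsManifold 𝓘(ℝ, SpacetimeModel n) ∞ M]

/-- The chronology relation `p ≪ q` of the spacetime: there is a future-directed timelike curve
from `p` to `q`. -/
def Chron (g : LorentzianStructure n M) (p q : M) : Prop :=
  ∃ (γ : ℝ → M) (a b : ℝ), PiecewiseCurve g.futureTimelike γ a b ∧ γ a = p ∧ γ b = q

/-- Strong causality: every neighbourhood `U` of a point `p` contains a neighbourhood `V` of `p`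
such that every causal curve with end points in `V` stays in `U`. -/
def StronglyCausal (g : LorentzianStructure n M) : Prop :=
  ∀ (p : M), ∀ U ∈ 𝓝 p, ∃ V ∈ 𝓝 p, V ⊆ U ∧
    ∀ (γ : ℝ → M) (a b : ℝ), PiecewiseCurve g.futureCausal γ a b → γ a ∈ V → γ b ∈ V →
      ∀ t ∈ Icc a b, γ t ∈ U

/-- `I⁻[S]` in `M`. -/
def past (g : LorentzianStructure n M) (S : Set M) : Set M := {x | ∃ y ∈ S, g.Chron x y}

/-- `I⁺[S]` in `M`. -/
def future (g : LorentzianStructure n M) (S : Set M) : Set M := {x | ∃ y ∈ S, g.Chron y x}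

/-- Past sets. -/
def IsPastSet (g : LorentzianStructure n M) (P : Set M) : Prop := g.past P = P

/-- Future sets. -/
def IsFutureSet (g : LorentzianStructure n M) (F : Set M) : Prop := g.future F = F

/-- Indecomposable past sets: nonempty past sets that are not the union of two proper subsets
that are past sets. -/
def IsIP (g : LorentzianStructure n M) (P : Set M) : Prop :=
  P.Nonempty ∧ g.IsPastSet P ∧
    ∀ A B : Set M, g.IsPastSet A → g.IsPastSet B → P = A ∪ B → A = P ∨ B = P

/-- Indecomposable future sets. -/
def IsIF (g : LorentzianStructure n M) (F : Set M) : Prop :=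
  F.Nonempty ∧ g.IsFutureSet F ∧
    ∀ A B : Set M, g.IsFutureSet A → g.IsFutureSet B → F = A ∪ B → A = F ∨ B = F

/-- The (open) common future of `S`. -/
def commonFuture (g : LorentzianStructure n M) (S : Set M) : Set M :=
  g.future {x | ∀ s ∈ S, g.Chron s x}

/-- The (open) common past of `S`. -/
def commonPast (g : LorentzianStructure n M) (S : Set M) : Set M :=
  g.past {x | ∀ s ∈ S, g.Chron x s}

/-- The Szabados relation between an IP `P` and an IF `F`: `F` is a maximal IF in the common
future of `P`, and `P` is a maximal IP in the common past of `F`. -/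
def Paired (g : LorentzianStructure n M) (P F : Set M) : Prop :=
  Maximal (fun F' ↦ g.IsIF F' ∧ F' ⊆ g.commonFuture P) F ∧
    Maximal (fun P' ↦ g.IsIP P' ∧ P' ⊆ g.commonPast F) P

/-- The causal completion: all pairs `(P, P*)` of an IP and an IF that are related, together with
`(P, ∅)` for each IP `P` that is related to no IF and `(∅, P*)` for each IF `P*` that is related to
no IP. The components are the past and the future, in `M`, of the point. -/
@[ext]
structure Completion (g : LorentzianStructure n M) where
  /-- the past of the point in `M` -/
  pastSet : Set M
  /-- the future of the point in `M` -/
  futureSet : Set M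
  isPoint : g.Paired pastSet futureSet ∨
    (g.IsIP pastSet ∧ futureSet = ∅ ∧ ∀ F, ¬ g.Paired pastSet F) ∨
    (g.IsIF futureSet ∧ pastSet = ∅ ∧ ∀ P, ¬ g.Paired P futureSet)

/-- Convergence of a sequence of subsets (past sets, or future sets) of `M`. -/
def SetsConverge (A : ℕ → Set M) (L : Set M) : Prop :=
  (∀ x ∈ L, ∀ᶠ k in atTop, x ∈ A k) ∧ (∀ x, x ∉ closure L → ∀ᶠ k in atTop, x ∉ closure (A k))

namespace Completion

variable {g : LorentzianStructure n M}

/-- Points whose nonempty future lies in the future of `S`. -/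
def LIF (S : Set g.Completion) : Set g.Completion :=
  {p | p.futureSet.Nonempty ∧ p.futureSet ⊆ ⋃ q ∈ S, q.futureSet}

/-- Points whose nonempty past lies in the past of `S`. -/
def LIP (S : Set g.Completion) : Set g.Completion :=
  {p | p.pastSet.Nonempty ∧ p.pastSet ⊆ ⋃ q ∈ S, q.pastSet}

/-- Closure in the future boundary: adds the points with empty future whose past is the limit
of the pasts of a sequence in `S`. -/
def closureFB (S : Set g.Completion) : Set g.Completion :=
  S ∪ {p | p.futureSet = ∅ ∧ ∃ s : ℕ → g.Completion, (∀ k, s k ∈ S) ∧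
    SetsConverge (fun k ↦ (s k).pastSet) p.pastSet}

/-- Closure in the past boundary. -/
def closurePB (S : Set g.Completion) : Set g.Completion :=
  S ∪ {p | p.pastSet = ∅ ∧ ∃ s : ℕ → g.Completion, (∀ k, s k ∈ S) ∧
    SetsConverge (fun k ↦ (s k).futureSet) p.futureSet}

/-- `L⁺(S)`. -/
def LPlus (S : Set g.Completion) : Set g.Completion := closureFB (S ∪ LIF S)

/-- `L⁻(S)`. -/
def LMinus (S : Set g.Completion) : Set g.Completion := closurePB (S ∪ LIP S)

/-- The topology of the completion: the coarsest one in which all `L⁺(S)`, `L⁻(S)` are closed. -/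
instance instTopologicalSpace : TopologicalSpace g.Completion :=
  TopologicalSpace.generateFrom
    {U | ∃ S : Set g.Completion, U = (LPlus S)ᶜ ∨ U = (LMinus S)ᶜ}

/-- The chronological past `I⁻_C(p)` in the completion. -/
def chronPast (p : g.Completion) : Set g.Completion :=
  {q | (q.futureSet ∩ p.pastSet).Nonempty}

end Completion

end LorentzianStructure

/-- Inner continuity of a set-valued map. -/
def InnerContinuous {X : Type*} [TopologicalSpace X] (F : X → Set X) : Prop :=
  ∀ (p : X) (C : Set X), IsCompact C → C ⊆ F p →
    ∃ U : Set X, IsOpen U ∧ p ∈ U ∧ ∀ u ∈ U, C ⊆ F u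

namespace LorentzianStructure.Completion

variable {n : ℕ} {M : Type*} [TopologicalSpace M] [ChartedSpace (SpacetimeModel n) M]
  [IsManifold 𝓘(ℝ, SpacetimeModel n) ∞ M] {g : LorentzianStructure n M}

/-! For each `x` in `M`, the points of the completion whose future contains `x` form an open set,
and so do those whose past contains `x`. The chronological past of `p` is the union of the former
sets over `x ∈ p.pastSet`, so finitely many such `x` suffice to cover a compact `C`. Requiring these
finitely many `x` to stay in the past of `u` is an open condition on `u`, it holds at `p`, and it
forces `C ⊆ u.chronPast`. -/

theorem isClosed_LPlus (S : Set g.Completion) : IsClosed (LPlus S) :=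
  ⟨TopologicalSpace.isOpen_generateFrom_of_mem ⟨S, Or.inl rfl⟩⟩

theorem isClosed_LMinus (S : Set g.Completion) : IsClosed (LMinus S) :=
  ⟨TopologicalSpace.isOpen_generateFrom_of_mem ⟨S, Or.inr rfl⟩⟩

/-- The set of points whose future misses `x` is a fixed point of `L⁺`. -/
theorem LPlus_setOf_notMem_futureSet (x : M) :
    LPlus {p : g.Completion | x ∉ p.futureSet} = {p | x ∉ p.futureSet} := by
  apply Subset.antisymm
  -- A future covered by futures missing `x` misses `x` itself, and the limit points added by
  -- `closureFB` have empty future, so the convergence condition plays no role.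
  · rintro p ((hp | ⟨-, hp⟩) | ⟨hp, -⟩)
    · exact hp
    · intro hx
      obtain ⟨q, hq, hxq⟩ := mem_iUnion₂.1 (hp hx)
      exact hq hxq
    · simp [hp]
  · exact fun p hp ↦ Or.inl (Or.inl hp)

/-- The set of points whose past misses `x` is a fixed point of `L⁻`. -/
theorem LMinus_setOf_notMem_pastSet (x : M) :
    LMinus {p : g.Completion | x ∉ p.pastSet} = {p | x ∉ p.pastSet} := by
  apply Subset.antisymm
  · rintro p ((hp | ⟨-, hp⟩) | ⟨hp, -⟩)
    · exact hp
    · intro hx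
      obtain ⟨q, hq, hxq⟩ := mem_iUnion₂.1 (hp hx)
      exact hq hxq
    · simp [hp]
  · exact fun p hp ↦ Or.inl (Or.inl hp)

/-- The complement is closed, being a value of `LPlus`, namely at itself. -/
theorem isOpen_setOf_mem_futureSet (x : M) : IsOpen {p : g.Completion | x ∈ p.futureSet} := by
  rw [← isClosed_compl_iff, compl_ofPred]
  exact LPlus_setOf_notMem_futureSet (g := g) x ▸ isClosed_LPlus _

theorem isOpen_setOf_mem_pastSet (x : M) : IsOpen {p : g.Completion | x ∈ p.pastSet} := by
  rw [← isClosed_compl_iff, compl_ofPred]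
  exact LMinus_setOf_notMem_pastSet (g := g) x ▸ isClosed_LMinus _

end LorentzianStructure.Completion

open LorentzianStructure.Completion in
theorem theorem1 {n : ℕ} {M : Type*} [TopologicalSpace M] [T2Space M]
    [SecondCountableTopology M] [ConnectedSpace M] [ChartedSpace (SpacetimeModel n) M]
    [IsManifold 𝓘(ℝ, SpacetimeModel n) ∞ M] (g : LorentzianStructure n M)
    (hg : g.StronglyCausal) :
    InnerContinuous (fun p : g.Completion ↦ p.chronPast) := by
  intro p C hC hCp
  -- The cover is indexed by witnesses in `M` of `q.futureSet ∩ p.pastSet` being nonempty.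
  obtain ⟨t, htp, ht, hCt⟩ := hC.elim_finite_subcover_image (b := p.pastSet)
    (c := fun x ↦ {q : g.Completion | x ∈ q.futureSet})
    (fun x _ ↦ isOpen_setOf_mem_futureSet x) (fun q hq ↦ by
      obtain ⟨x, hxq, hxp⟩ := hCp hq
      exact mem_biUnion hxp hxq)
  refine ⟨⋂ x ∈ t, {u | x ∈ u.pastSet}, ht.isOpen_biInter fun x _ ↦ isOpen_setOf_mem_pastSet x,
    mem_iInter₂.2 fun x hx ↦ htp hx, fun u hu q hq ↦ ?_⟩
  -- The `x ∈ t` whose set covers `q` also lies in `u.pastSet`, so the same witness serves for `u`.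
  obtain ⟨x, hx, hxq⟩ := mem_iUnion₂.1 (hCt hq)
  exact ⟨x, hxq, mem_iInter₂.1 hu x hx⟩
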